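/- Let $n \ge 0$ be an integer. There is a constant $C = C(n) > 0$, depending only on $n$, such that for every prime $p$ the following holds: if $M$ is chosen uniformly at random from $\mathrm{SL}(n,\mathbb{F}_p)$, where $\mathbb{F}_p = \mathbb{Z}/p\mathbb{Z}$, then the probability that the characteristic polynomial $\det(xI - M) \in \mathbb{F}_p[x]$ has a proper monic factor (that is, a monic divisor $q \in \mathbb{F}_p[x]$ with $1 \le \deg q \le n-1$) with constant term $q(0) = 1$ is at most $C/p$. -/

import Mathlib

open scoped Polynomial MatrixGroups

/-- The polynomial `f` has a proper polynomial factor (monic, of degree `m` with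
`1 ≤ m < deg f`) whose constant term is `α`. -/
def HasProperFactorWithConstTerm {R : Type*} [CommRing R] (f : R[X]) (α : R) : Prop :=
  ∃ q : R[X], q.Monic ∧ q ∣ f ∧ 1 ≤ q.natDegree ∧ q.natDegree < f.natDegree ∧ q.coeff 0 = α

/-- The probability that a uniformly random element of `SL(n, 𝔽_p)` lies in the set `S`. -/
noncomputable def slProb (n p : ℕ) (S : Set SL(n, ZMod p)) : ℝ :=
  (Nat.card S : ℝ) / (Nat.card SL(n, ZMod p) : ℝ)

/-!
Write `q` for the order of a finite field `K`. If the characteristic polynomial of `M ∈ SL(n, K)`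
is `g * h` with `g` monic of degree `d`, `1 ≤ d < n`, and `g(0) = 1`, then `h` is monic of degree
`n - d` with constant term `(-1) ^ n`, so there are only `q ^ (d - 1) * q ^ (n - d - 1) = q ^ (n - 2)`
such products for each `d`. Requiring a factor with constant term `1` thus costs one dimension in the
space of characteristic polynomials of elements of `SL(n, K)`, which has dimension `n - 1`. The
probability is `O(1 / q)` because no characteristic polynomial is attained much more often than
average: `Matrix.ncard_charpoly_eq_le` shows that at most `2 ^ (n ^ 2) * q ^ (n * (n - 1))` matrices
share a given one, whereas `|SL(n, K)| ≥ q ^ (n ^ 2 - 1) / 2 ^ n` by the formula for the order of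
`GL(n, K)`.

The bound on the fibres is an induction on the dimension. Fix a vector `v ≠ 0` of `V`, and let `W`
be the cyclic subspace that `v` generates under `φ`, of dimension `k ≥ 1`. The characteristic
polynomial `g` of `φ` on `W` is one of the at most `2 ^ n` monic divisors of `f = charpoly φ`. By
Cayley–Hamilton, `g` and the vectors `φ v, …, φ ^ (k - 1) v` determine both `W` and `φ` on `W`; there
are at most `q ^ (n * (k - 1))` choices for these vectors. What remains is the endomorphism induced
on `V ⧸ W`, with characteristic polynomial `f / g`, and a linear map `V ⧸ W → W`. With `r = n - k`,
the induction hypothesis gives the exponent `n * (k - 1) + r * (r - 1) + r * k ≤ n * (n - 1)`.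
-/

/-! ### Block triangular endomorphisms -/

open Module.Basis in
/-- The characteristic polynomial is multiplicative along an invariant subspace, because a basis of
`V` adapted to `W` makes the matrix of `φ` block triangular. -/
theorem LinearMap.charpoly_eq_charpoly_restrict_mul_charpoly_mapQ {K V : Type*} [Field K]
    [AddCommGroup V] [Module K V] [FiniteDimensional K V] (W : Submodule K V) (φ : V →ₗ[K] V)
    (hφ : W ≤ W.comap φ) :
    φ.charpoly = (φ.restrict hφ).charpoly * (W.mapQ W φ hφ).charpoly := by
  let bW := Module.Free.chooseBasis K W
  let bQ := Module.Free.chooseBasis K (V ⧸ W)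
  let b := sumQuot bW bQ
  suffices LinearMap.toMatrix b b φ = Matrix.fromBlocks (LinearMap.toMatrix bW bW (φ.restrict hφ))
      (Matrix.of fun i l ↦ (b.repr (φ (b (Sum.inr l)))) (Sum.inl i)) 0
      (LinearMap.toMatrix bQ bQ (W.mapQ W φ hφ)) by
    rw [← LinearMap.charpoly_toMatrix φ b, this, ← LinearMap.charpoly_toMatrix _ bW,
      ← LinearMap.charpoly_toMatrix _ bQ, Matrix.charpoly_fromBlocks_zero₂₁]
  ext u v
  rcases u with i | j <;> rcases v with k | l
  · simp only [b, sumQuot_inl, Matrix.fromBlocks_apply₁₁, LinearMap.toMatrix_apply]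
    apply sumQuot_repr_inl_of_mem
  · simp [LinearMap.toMatrix_apply, Matrix.fromBlocks_apply₁₂]
  · suffices W.mkQ (φ (bW k)) = 0 by simp [LinearMap.toMatrix_apply, b, this]
    rw [← LinearMap.mem_ker, Submodule.ker_mkQ]
    exact hφ (Submodule.coe_mem (bW k))
  · simp only [LinearMap.toMatrix_apply, sumQuot_repr_inr, Matrix.fromBlocks_apply₂₂, b]
    rw [← sumQuot_inr bW bQ l, W.mapQ_apply]
    simp

/-! ### Monic divisors of a polynomial -/

open UniqueFactorizationMonoid in
theorem Polynomial.card_normalizedFactors_le_natDegree {K : Type*} [Field K] [DecidableEq K]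
    {f : K[X]} (hf : f ≠ 0) : (normalizedFactors f).card ≤ f.natDegree := by
  have hmonic : ∀ g ∈ normalizedFactors f, g.Monic := fun g hg ↦ by
    rw [← normalize_normalized_factor g hg]
    exact Polynomial.monic_normalize (irreducible_of_normalized_factor g hg).ne_zero
  have hdeg := Polynomial.natDegree_multiset_prod_of_monic (normalizedFactors f) hmonic
  rw [Polynomial.natDegree_eq_of_degree_eq
    (Polynomial.degree_eq_degree_of_associated (prod_normalizedFactors hf))] at hdeg
  rw [hdeg]
  have := Multiset.card_nsmul_le_sum (s := (normalizedFactors f).map Polynomial.natDegree) (a := 1)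
    (by
      intro d hd
      obtain ⟨g, hg, rfl⟩ := Multiset.mem_map.1 hd
      exact (irreducible_of_normalized_factor g hg).natDegree_pos)
  simpa using this

open UniqueFactorizationMonoid in
/-- A monic divisor of `f` is the product of a sub-multiset of the irreducible factors of `f`, so a
polynomial of degree `n` has at most `2 ^ n` monic divisors. -/
theorem Polynomial.exists_finset_monic_dvd_card_le {K : Type*} [Field K] {f : K[X]} (hf : f ≠ 0) :
    ∃ D : Finset K[X], (∀ g, g ∈ D ↔ g.Monic ∧ g ∣ f) ∧ D.card ≤ 2 ^ f.natDegree := by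
  classical
  let D := ((normalizedFactors f).powerset.map Multiset.prod).toFinset
  have hD : ∀ g : K[X], g.Monic → g ∣ f → g ∈ D := fun g hg hgf ↦ by
    refine Multiset.mem_toFinset.2 (Multiset.mem_map.2 ⟨normalizedFactors g, ?_, ?_⟩)
    · exact Multiset.mem_powerset.2
        ((dvd_iff_normalizedFactors_le_normalizedFactors hg.ne_zero hf).1 hgf)
    · rw [prod_normalizedFactors_eq hg.ne_zero, hg.normalize_eq_self]
  refine ⟨D.filter fun g ↦ g.Monic ∧ g ∣ f, fun g ↦ ?_, ?_⟩
  · simpa using hD g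
  · calc _ ≤ D.card := Finset.card_filter_le _ _
      _ ≤ ((normalizedFactors f).powerset.map Multiset.prod).card := Multiset.toFinset_card_le _
      _ = 2 ^ (normalizedFactors f).card := by simp
      _ ≤ _ := Nat.pow_le_pow_right two_pos (Polynomial.card_normalizedFactors_le_natDegree hf)

/-! ### Endomorphisms with given characteristic polynomial -/

section Fibre

variable {K V : Type*} [Field K] [AddCommGroup V] [Module K V]

/-- For an endomorphism that is fixed on an invariant subspace `W`, there remain the induced
endomorphism of `V ⧸ W`, whose characteristic polynomial is determined by `f`, and a linear map
`V ⧸ W → W`. -/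
theorem LinearMap.ncard_charpoly_eq_of_eqOn_le [Finite K] [FiniteDimensional K V]
    (W : Submodule K V) (φ₀ : V →ₗ[K] V) (hφ₀ : W ≤ W.comap φ₀) (f : K[X]) (B : ℕ)
    (hB : ∀ h : K[X], {χ : (V ⧸ W) →ₗ[K] (V ⧸ W) | χ.charpoly = h}.ncard ≤ B) :
    {φ : V →ₗ[K] V | Set.EqOn φ φ₀ W ∧ φ.charpoly = f}.ncard ≤
      B * Nat.card K ^ (Module.finrank K (V ⧸ W) * Module.finrank K W) := by
  obtain ⟨π, hπ⟩ := W.subtype.exists_leftInverse_of_injective W.ker_subtype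
  obtain ⟨s, hs⟩ := W.mkQ.exists_rightInverse_of_surjective W.range_mkQ
  have hπ' (w : W) : π w = w := LinearMap.congr_fun hπ w
  have hs' (u : V ⧸ W) : W.mkQ (s u) = u := LinearMap.congr_fun hs u
  have : Finite V := Module.finite_of_finite K
  have : Finite (V ⧸ W) := Module.finite_of_finite K
  have : Finite ((V ⧸ W) →ₗ[K] (V ⧸ W)) := Module.finite_of_finite K
  have : Finite ((V ⧸ W) →ₗ[K] W) := Module.finite_of_finite K
  let T := (φ₀.restrict hφ₀).charpoly
  -- In block form relative to a complement of `W`, the map `Φ` reads off the second block column.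
  let Φ : (V →ₗ[K] V) → ((V ⧸ W) →ₗ[K] (V ⧸ W)) × ((V ⧸ W) →ₗ[K] W) :=
    fun φ ↦ (W.mkQ ∘ₗ φ ∘ₗ s, π ∘ₗ φ ∘ₗ s)
  have hmaps : ∀ φ ∈ {φ : V →ₗ[K] V | Set.EqOn φ φ₀ W ∧ φ.charpoly = f},
      Φ φ ∈ {χ : (V ⧸ W) →ₗ[K] (V ⧸ W) | χ.charpoly = f / T} ×ˢ
        (Set.univ : Set ((V ⧸ W) →ₗ[K] W)) := by
    rintro φ ⟨hφ, rfl⟩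
    have hW : W ≤ W.comap φ := fun w hw ↦ by
      simpa [hφ hw] using hφ₀ hw
    have hres : φ.restrict hW = φ₀.restrict hφ₀ := by
      ext w; exact hφ w.2
    have hQ : W.mkQ ∘ₗ φ ∘ₗ s = W.mapQ W φ hW := by
      ext v
      have hv := hs' (W.mkQ v)
      simp only [LinearMap.comp_apply]
      conv_rhs => rw [← hv]
      rfl
    refine ⟨?_, trivial⟩
    simp only [Φ, Set.mem_ofPred_eq, hQ]
    rw [φ.charpoly_eq_charpoly_restrict_mul_charpoly_mapQ W hW, hres,
      mul_div_cancel_left₀ _ (show T ≠ 0 from (φ₀.restrict hφ₀).charpoly_monic.ne_zero)]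
  have hinj : Set.InjOn Φ {φ : V →ₗ[K] V | Set.EqOn φ φ₀ W ∧ φ.charpoly = f} := by
    rintro φ ⟨hφ, -⟩ φ' ⟨hφ', -⟩ h
    have h₁ (u) : W.mkQ (φ (s u)) = W.mkQ (φ' (s u)) := LinearMap.congr_fun (Prod.ext_iff.1 h).1 u
    have h₂ (u) : π (φ (s u)) = π (φ' (s u)) := LinearMap.congr_fun (Prod.ext_iff.1 h).2 u
    -- An element of `W` killed by the projection `π` is zero.
    have h₃ (u) : φ (s u) = φ' (s u) := by
      have hmem : φ (s u) - φ' (s u) ∈ W := (Submodule.Quotient.eq W).1 (h₁ u)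
      have := hπ' ⟨_, hmem⟩
      rw [map_sub, h₂, sub_self] at this
      exact sub_eq_zero.1 (congrArg Subtype.val this).symm
    ext v
    have hmem : v - s (W.mkQ v) ∈ W := (Submodule.Quotient.eq W).1 (hs' (W.mkQ v)).symm
    have := (hφ hmem).trans (hφ' hmem).symm
    rwa [map_sub, map_sub, h₃, sub_left_inj] at this
  refine (Set.ncard_le_ncard_of_injOn Φ hmaps hinj).trans ?_
  rw [Set.ncard_prod, Set.ncard_univ, Module.natCard_eq_pow_finrank (K := K),
    Module.finrank_linearMap]
  exact Nat.mul_le_mul_right _ (hB _)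

/-- Every vector `v` is a cyclic vector for some invariant subspace `W`. The polynomial `g` is the
characteristic polynomial of `φ` on `W`, and Cayley–Hamilton on `W` bounds the number of iterates of
`v` needed to span `W`. -/
theorem LinearMap.exists_monic_dvd_charpoly_span [FiniteDimensional K V] (φ : V →ₗ[K] V) (v : V) :
    ∃ g : K[X], g.Monic ∧ g ∣ φ.charpoly ∧ Polynomial.aeval φ g v = 0 ∧
      Module.finrank K (Submodule.span K ((fun i ↦ (φ ^ i) v) '' Set.Iio g.natDegree)) =
        g.natDegree := by
  let W : Submodule K V := Submodule.span K (Set.range fun i : ℕ ↦ (φ ^ i) v)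
  have hW : W ≤ W.comap φ := by
    refine Submodule.span_le.2 ?_
    rintro _ ⟨i, rfl⟩
    refine Submodule.subset_span ⟨i + 1, ?_⟩
    simp [pow_succ']
  have hvW : v ∈ W := Submodule.subset_span ⟨0, by simp⟩
  let ψ : W →ₗ[K] W := φ.restrict (p := W) (q := W) fun _ hw ↦ hW hw
  have hres (p : K[X]) (w : W) : (Polynomial.aeval ψ p w : V) = Polynomial.aeval φ p w := by
    induction p using Polynomial.induction_on' with
    | add p q hp hq => simp [hp, hq]
    | monomial n a =>
      have : ((ψ ^ n) w : V) = (φ ^ n) w := by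
        rw [Module.End.pow_restrict, LinearMap.restrict_apply]
      simp [Polynomial.aeval_monomial, this]
  have hmem (p : K[X]) : Polynomial.aeval φ (p %ₘ ψ.charpoly) v ∈
      Submodule.span K ((fun i ↦ (φ ^ i) v) '' Set.Iio ψ.charpoly.natDegree) := by
    by_cases h1 : ψ.charpoly = 1
    · simp [h1]
    rw [Polynomial.aeval_eq_sum_range, LinearMap.sum_apply]
    refine Submodule.sum_mem _ fun i hi ↦ ?_
    rw [LinearMap.smul_apply]
    refine Submodule.smul_mem _ _ (Submodule.subset_span ⟨i, ?_, rfl⟩)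
    have := Polynomial.natDegree_modByMonic_lt p ψ.charpoly_monic h1
    have := Finset.mem_range.1 hi
    simp only [Set.mem_Iio]; omega
  refine ⟨ψ.charpoly, ψ.charpoly_monic, ⟨_, φ.charpoly_eq_charpoly_restrict_mul_charpoly_mapQ W hW⟩,
    ?_, ?_⟩
  · rw [← hres _ ⟨v, hvW⟩, ψ.aeval_self_charpoly]; rfl
  · have : Submodule.span K ((fun i ↦ (φ ^ i) v) '' Set.Iio ψ.charpoly.natDegree) = W := by
      refine le_antisymm (Submodule.span_mono (Set.image_subset_range _ _)) (Submodule.span_le.2 ?_)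
      rintro _ ⟨i, rfl⟩
      have := hmem (Polynomial.X ^ i)
      rw [← hres _ ⟨v, hvW⟩, ← ψ.aeval_eq_aeval_mod_charpoly, hres] at this
      simpa using this
    rw [this, ψ.charpoly_natDegree]

/-- An endomorphism is determined on a cyclic subspace of dimension `m + 1` by the iterates
`φ v, …, φ ^ m v` of the cyclic vector `v` and by a monic polynomial `g` of degree `m + 1` that
annihilates `v`. -/
theorem LinearMap.ncard_charpoly_eq_of_iterates_eq_le [Finite K] [FiniteDimensional K V] (v : V)
    (f g : K[X]) (hg : g.Monic) (m : ℕ) (hm : g.natDegree = m + 1) (w : Fin m → V)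
    (r : ℕ) (hr : Module.finrank K V = m + 1 + r) (B : ℕ)
    (hB : ∀ W : Submodule K V, Module.finrank K (V ⧸ W) = r →
      ∀ h : K[X], {χ : (V ⧸ W) →ₗ[K] (V ⧸ W) | χ.charpoly = h}.ncard ≤ B) :
    {φ : V →ₗ[K] V | φ.charpoly = f ∧ Polynomial.aeval φ g v = 0 ∧
      Module.finrank K (Submodule.span K ((fun i ↦ (φ ^ i) v) '' Set.Iio g.natDegree)) =
        g.natDegree ∧ ∀ i : Fin m, (φ ^ (i.val + 1)) v = w i}.ncard ≤
      B * Nat.card K ^ (r * (m + 1)) := by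
  set S := {φ : V →ₗ[K] V | φ.charpoly = f ∧ Polynomial.aeval φ g v = 0 ∧
    Module.finrank K (Submodule.span K ((fun i ↦ (φ ^ i) v) '' Set.Iio g.natDegree)) =
      g.natDegree ∧ ∀ i : Fin m, (φ ^ (i.val + 1)) v = w i}
  obtain hS | ⟨φ₀, hφ₀⟩ := S.eq_empty_or_nonempty
  · simp [hS]
  have : Finite (V →ₗ[K] V) := Module.finite_of_finite K
  have hpow : ∀ φ ∈ S, ∀ i ≤ m, (φ ^ i) v = (φ₀ ^ i) v := by
    rintro φ hφ (_ | i) hi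
    · simp
    · exact (hφ.2.2.2 ⟨i, hi⟩).trans (hφ₀.2.2.2 ⟨i, hi⟩).symm
  -- The next iterate is a combination of the previous ones, with coefficients read off from `g`.
  have htop : ∀ φ ∈ S, (φ ^ (m + 1)) v = -∑ i ∈ Finset.range (m + 1), g.coeff i • (φ₀ ^ i) v := by
    intro φ hφ
    have h := hφ.2.1
    rw [Polynomial.aeval_eq_sum_range, hm, Finset.sum_range_succ, ← hm, hg.coeff_natDegree,
      one_smul,
      hm, LinearMap.add_apply, LinearMap.sum_apply] at h
    rw [eq_neg_iff_add_eq_zero, add_comm, ← h]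
    congr 1
    refine Finset.sum_congr rfl fun i hi ↦ ?_
    rw [LinearMap.smul_apply, hpow φ hφ i (Nat.lt_succ_iff.1 (Finset.mem_range.1 hi))]
  let W : Submodule K V := Submodule.span K ((fun i ↦ (φ₀ ^ i) v) '' Set.Iio g.natDegree)
  have hWrank : Module.finrank K W = m + 1 := hφ₀.2.2.1.trans hm
  have hquot : Module.finrank K (V ⧸ W) = r := by
    have := W.finrank_quotient_add_finrank
    omega
  have hW : W ≤ W.comap φ₀ := by
    refine Submodule.span_le.2 ?_
    rintro _ ⟨i, hi, rfl⟩
    have hgen : ∀ j < m + 1, (φ₀ ^ j) v ∈ W := fun j hj ↦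
      Submodule.subset_span ⟨j, by simpa [hm] using hj, rfl⟩
    have hsucc : φ₀ ((φ₀ ^ i) v) = (φ₀ ^ (i + 1)) v := by simp [pow_succ']
    change φ₀ ((φ₀ ^ i) v) ∈ W
    rw [hsucc]
    have hi' : i < m + 1 := by simpa [hm] using hi
    obtain h | rfl := Nat.lt_succ_iff_lt_or_eq.1 hi'
    · exact hgen _ (by omega)
    · rw [htop φ₀ hφ₀]
      exact W.neg_mem (W.sum_mem fun j hj ↦ W.smul_mem _ (hgen j (Finset.mem_range.1 hj)))
  have hsub : S ⊆ {φ : V →ₗ[K] V | Set.EqOn φ φ₀ W ∧ φ.charpoly = f} := by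
    intro φ hφ
    refine ⟨LinearMap.eqOn_span ?_, hφ.1⟩
    rintro _ ⟨i, hi, rfl⟩
    have hi' : i < m + 1 := by simpa [hm] using hi
    have hsucc (ψ : V →ₗ[K] V) : ψ ((ψ ^ i) v) = (ψ ^ (i + 1)) v := by simp [pow_succ']
    change φ ((φ₀ ^ i) v) = φ₀ ((φ₀ ^ i) v)
    rw [hsucc, ← hpow φ hφ i (by omega), hsucc]
    obtain h | rfl := Nat.lt_succ_iff_lt_or_eq.1 hi'
    · exact hpow φ hφ _ (by omega)
    · rw [htop φ hφ, htop φ₀ hφ₀]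
  refine (Set.ncard_le_ncard hsub).trans ?_
  have := LinearMap.ncard_charpoly_eq_of_eqOn_le W φ₀ hW f B (hB W hquot)
  rwa [hquot, hWrank] at this

/-- The fibres of the characteristic polynomial map have the expected size `q ^ (n ^ 2 - n)`, up to
a factor depending only on `n`. -/
theorem LinearMap.ncard_charpoly_eq_le [Finite K] (n : ℕ) :
    ∀ (V : Type*) [AddCommGroup V] [Module K V] [FiniteDimensional K V],
      Module.finrank K V = n → ∀ f : K[X],
      {φ : V →ₗ[K] V | φ.charpoly = f}.ncard ≤ 2 ^ n ^ 2 * Nat.card K ^ (n * (n - 1)) := by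
  classical
  induction n using Nat.strong_induction_on with
  | _ n ih =>
  intro V _ _ _ hn f
  have : Finite V := Module.finite_of_finite K
  have : Finite (V →ₗ[K] V) := Module.finite_of_finite K
  obtain rfl | hpos := Nat.eq_zero_or_pos n
  · have : Subsingleton V := Module.finrank_zero_iff.1 hn
    simpa using Set.ncard_le_one_of_subsingleton {φ : V →ₗ[K] V | φ.charpoly = f}
  obtain hS | ⟨φ₁, hφ₁⟩ := Set.eq_empty_or_nonempty {φ : V →ₗ[K] V | φ.charpoly = f}
  · simp [hS]
  have hfm : f.Monic := hφ₁ ▸ φ₁.charpoly_monic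
  have hfn : f.natDegree = n := by rw [← hn, ← φ₁.charpoly_natDegree, hφ₁]
  have : Nontrivial V := Module.nontrivial_of_finrank_pos (hn ▸ hpos)
  obtain ⟨v, hv⟩ := exists_ne (0 : V)
  obtain ⟨D, hD, hDcard⟩ := Polynomial.exists_finset_monic_dvd_card_le hfm.ne_zero
  have := Fintype.ofFinite V
  let S (g : K[X]) (w : Fin (g.natDegree - 1) → V) : Set (V →ₗ[K] V) :=
    {φ | φ.charpoly = f ∧ Polynomial.aeval φ g v = 0 ∧
      Module.finrank K (Submodule.span K ((fun i ↦ (φ ^ i) v) '' Set.Iio g.natDegree)) =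
        g.natDegree ∧ ∀ i : Fin (g.natDegree - 1), (φ ^ (i.val + 1)) v = w i}
  have hcover : {φ : V →ₗ[K] V | φ.charpoly = f} ⊆
      ⋃ g ∈ D.filter fun g ↦ g.natDegree ≠ 0, ⋃ w, S g w := by
    rintro φ rfl
    obtain ⟨g, hg, hgf, hgv, hrank⟩ := φ.exists_monic_dvd_charpoly_span v
    have hg0 : g.natDegree ≠ 0 := fun h ↦ hv <| by
      simpa [hg.natDegree_eq_zero.1 h] using hgv
    simp only [Set.mem_iUnion]
    exact ⟨g, Finset.mem_filter.2 ⟨(hD g).2 ⟨hg, hgf⟩, hg0⟩, fun i ↦ (φ ^ (i.val + 1)) v,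
      rfl, hgv, hrank, fun _ ↦ rfl⟩
  have hterm : ∀ g ∈ D.filter fun g ↦ g.natDegree ≠ 0, (⋃ w, S g w).ncard ≤
      2 ^ (n - 1) ^ 2 * Nat.card K ^ (n * (n - 1)) := by
    intro g hgD
    obtain ⟨hgD, hg0⟩ := Finset.mem_filter.1 hgD
    obtain ⟨hg, hgf⟩ := (hD g).1 hgD
    obtain ⟨m, hm⟩ := Nat.exists_eq_succ_of_ne_zero hg0
    obtain ⟨r, hr⟩ := Nat.exists_eq_add_of_le
      (show m + 1 ≤ n by
        have := Polynomial.natDegree_le_of_dvd hgf hfm.ne_zero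
        omega)
    have hm' : g.natDegree - 1 = m := by omega
    -- The fibre over the iterates `w`, where `r` is the dimension of the quotient.
    have hS (w) : (S g w).ncard ≤ 2 ^ r ^ 2 * Nat.card K ^ (r * (r - 1)) *
        Nat.card K ^ (r * (m + 1)) := by
      subst hm'
      exact LinearMap.ncard_charpoly_eq_of_iterates_eq_le v f g hg _ hm w r (hn.trans hr) _
        fun W hW h ↦ ih r (by omega) (V ⧸ W) hW h
    have hcard : Fintype.card (Fin (g.natDegree - 1) → V) = Nat.card K ^ (n * m) := by
      rw [Fintype.card_fun, Fintype.card_fin, ← Nat.card_eq_fintype_card,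
        Module.natCard_eq_pow_finrank (K := K), hn, hm', pow_mul]
    calc (⋃ w, S g w).ncard ≤ ∑ w, (S g w).ncard := by
          simpa using Finset.univ.set_ncard_biUnion_le (S g)
      _ ≤ ∑ w : Fin (g.natDegree - 1) → V, 2 ^ r ^ 2 * Nat.card K ^ (r * (r - 1)) *
          Nat.card K ^ (r * (m + 1)) := Finset.sum_le_sum fun w _ ↦ hS w
      _ = 2 ^ r ^ 2 * Nat.card K ^ (n * m + r * (r - 1) + r * (m + 1)) := by
          rw [Finset.sum_const, Finset.card_univ, hcard, smul_eq_mul]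
          ring
      _ ≤ _ := by
          refine Nat.mul_le_mul (Nat.pow_le_pow_right two_pos
            (Nat.pow_le_pow_left (by omega) 2)) (Nat.pow_le_pow_right Nat.card_pos ?_)
          subst hr
          rcases r with _ | r
          · simp
          · simp only [Nat.add_sub_cancel, show m + 1 + (r + 1) - 1 = m + (r + 1) by omega]
            nlinarith
  calc _ ≤ (⋃ g ∈ D.filter fun g ↦ g.natDegree ≠ 0, ⋃ w, S g w).ncard := Set.ncard_le_ncard hcover
    _ ≤ ∑ g ∈ D.filter fun g ↦ g.natDegree ≠ 0, (⋃ w, S g w).ncard :=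
        Finset.set_ncard_biUnion_le _ _
    _ ≤ (D.filter fun g ↦ g.natDegree ≠ 0).card * (2 ^ (n - 1) ^ 2 * Nat.card K ^ (n * (n - 1))) :=
        Finset.sum_le_card_nsmul _ _ _ hterm
    _ ≤ 2 ^ n * (2 ^ (n - 1) ^ 2 * Nat.card K ^ (n * (n - 1))) :=
        Nat.mul_le_mul_right _ ((Finset.card_filter_le _ _).trans (hfn ▸ hDcard))
    _ ≤ _ := by
        rw [← mul_assoc, ← pow_add]
        refine Nat.mul_le_mul_right _ (Nat.pow_le_pow_right two_pos ?_)
        obtain ⟨m, rfl⟩ := Nat.exists_eq_add_of_le' hpos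
        simp only [Nat.add_sub_cancel]
        nlinarith

theorem Matrix.ncard_charpoly_eq_le [Finite K] (n : ℕ) (f : K[X]) :
    {M : Matrix (Fin n) (Fin n) K | M.charpoly = f}.ncard ≤
      2 ^ n ^ 2 * Nat.card K ^ (n * (n - 1)) := by
  have : Finite ((Fin n → K) →ₗ[K] (Fin n → K)) := Module.finite_of_finite K
  refine (Set.ncard_le_ncard_of_injOn (t := {φ : (Fin n → K) →ₗ[K] (Fin n → K) | φ.charpoly = f})
    Matrix.toLin' ?_ Matrix.toLin'.injective.injOn).trans
    (LinearMap.ncard_charpoly_eq_le n (Fin n → K) (by simp) f)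
  rintro M rfl
  exact Matrix.charpoly_toLin' M

end Fibre

/-! ### The order of the special linear group -/

theorem Matrix.SpecialLinearGroup.card_GL_le_card_mul {K : Type*} [Field K] [Finite K] (n : ℕ) :
    Nat.card (GL (Fin n) K) ≤ Nat.card SL(n, K) * Nat.card K := by
  let det : GL (Fin n) K →* Kˣ := Matrix.GeneralLinearGroup.det
  rw [← det.ker.card_mul_index, Subgroup.index_ker]
  refine Nat.mul_le_mul (Nat.card_le_card_of_injective
    (fun A : det.ker ↦ (⟨A.1.1, congrArg Units.val A.2⟩ : SL(n, K))) ?_) ?_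
  · intro A A' h
    exact Subtype.ext (Units.ext (congrArg Subtype.val h))
  · exact Nat.card_le_card_of_injective (fun u : det.range ↦ (u.1 : K))
      (Units.val_injective.comp Subtype.val_injective)

/-- Each factor `q ^ n - q ^ i` of the order of `GL(n, K)` is at least `q ^ n / 2`, and `GL(n, K)` is
at most `q` times as large as `SL(n, K)`. -/
theorem Matrix.SpecialLinearGroup.pow_le_card {K : Type*} [Field K] [Finite K] (n : ℕ) :
    Nat.card K ^ (n ^ 2) ≤ 2 ^ n * Nat.card SL(n, K) * Nat.card K := by
  have := Fintype.ofFinite K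
  have hq : 2 ≤ Nat.card K := Finite.one_lt_card
  have hterm (i : Fin n) : Nat.card K ^ n ≤ 2 * (Nat.card K ^ n - Nat.card K ^ i.val) := by
    have h : 2 * Nat.card K ^ i.val ≤ Nat.card K ^ n :=
      calc 2 * Nat.card K ^ i.val ≤ Nat.card K ^ (i.val + 1) := by
            rw [pow_succ']; exact Nat.mul_le_mul_right _ hq
        _ ≤ _ := Nat.pow_le_pow_right (by omega) i.2
    omega
  have hGL : Nat.card K ^ (n ^ 2) ≤ 2 ^ n * Nat.card (GL (Fin n) K) := by
    rw [Matrix.card_GL_field, ← Nat.card_eq_fintype_card]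
    calc Nat.card K ^ (n ^ 2) = ∏ _i : Fin n, Nat.card K ^ n := by
          rw [Finset.prod_const, Finset.card_univ, Fintype.card_fin, sq, pow_mul]
      _ ≤ ∏ i : Fin n, 2 * (Nat.card K ^ n - Nat.card K ^ i.val) :=
          Finset.prod_le_prod' fun i _ ↦ hterm i
      _ = _ := by rw [Finset.prod_mul_distrib]; simp
  rw [mul_assoc]
  exact hGL.trans (Nat.mul_le_mul_left _ (card_GL_le_card_mul n))

/-! ### Polynomials with a factor of constant term one -/

/-- A monic polynomial of degree `d ≥ 1` with prescribed constant term is given by its remaining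
`d - 1` coefficients. -/
theorem Polynomial.exists_finset_monic_coeff_zero_card_le {K : Type*} [Field K] [Finite K] (d : ℕ)
    (a : K) (hd : d ≠ 0) : ∃ Q : Finset K[X],
      (∀ g : K[X], g.Monic → g.natDegree = d → g.coeff 0 = a → g ∈ Q) ∧
      Q.card ≤ Nat.card K ^ (d - 1) := by
  classical
  have := Fintype.ofFinite K
  obtain ⟨e, rfl⟩ := Nat.exists_eq_succ_of_ne_zero hd
  let F (c : Fin e → K) : K[X] := Polynomial.X ^ (e + 1) +
    ((∑ i : Fin e, Polynomial.C (c i) * Polynomial.X ^ (i.val + 1)) + Polynomial.C a)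
  refine ⟨Finset.univ.image F, fun g hg hgd hg0 ↦ Finset.mem_image.2
    ⟨fun i ↦ g.coeff (i.val + 1), Finset.mem_univ _, ?_⟩, Finset.card_image_le.trans (by simp)⟩
  conv_rhs => rw [hg.as_sum, hgd, Finset.sum_range_succ', hg0, ← Fin.sum_univ_eq_sum_range
    (fun i ↦ Polynomial.C (g.coeff (i + 1)) * Polynomial.X ^ (i + 1))]
  simp [F]

/-- Once the degree `d` of a factor with constant term `1` is fixed, one coefficient of each of the
two factors is prescribed. The truncated exponent `n - 2` is harmless, since a polynomial of degree
less than `2` has no proper factor. -/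
theorem Polynomial.exists_finset_hasProperFactor_card_le {K : Type*} [Field K] [Finite K] (n : ℕ)
    (b : K) : ∃ F : Finset K[X],
      (∀ f : K[X], f.Monic → f.natDegree = n → f.coeff 0 = b →
        HasProperFactorWithConstTerm f 1 → f ∈ F) ∧
      F.card ≤ n * Nat.card K ^ (n - 2) := by
  classical
  have hQ (d : ℕ) (a : K) : ∃ Q : Finset K[X], d ≠ 0 →
      (∀ g : K[X], g.Monic → g.natDegree = d → g.coeff 0 = a → g ∈ Q) ∧
      Q.card ≤ Nat.card K ^ (d - 1) := by
    obtain rfl | hd := eq_or_ne d 0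
    · exact ⟨∅, by simp⟩
    · exact (Polynomial.exists_finset_monic_coeff_zero_card_le d a hd).imp fun _ h _ ↦ h
  choose Q hQ using hQ
  refine ⟨(Finset.Ico 1 n).biUnion fun d ↦ Finset.image₂ (· * ·) (Q d 1) (Q (n - d) b), ?_, ?_⟩
  · rintro f hf hfn hf0 ⟨g, hg, ⟨h, rfl⟩, h1, hlt, hg0⟩
    have hh : h.Monic := hg.of_mul_monic_left hf
    rw [hg.natDegree_mul hh] at hfn hlt
    rw [Polynomial.mul_coeff_zero, hg0, one_mul] at hf0
    refine Finset.mem_biUnion.2 ⟨g.natDegree, Finset.mem_Ico.2 ⟨h1, by omega⟩,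
      Finset.mem_image₂_of_mem ((hQ _ _ (by omega)).1 g hg rfl hg0)
        ((hQ _ _ (by omega)).1 h hh (by omega) hf0)⟩
  · refine (Finset.card_biUnion_le_card_mul _ _ (Nat.card K ^ (n - 2)) fun d hd ↦ ?_).trans
      (Nat.mul_le_mul_right _ (by simp))
    have hd := Finset.mem_Ico.1 hd
    calc _ ≤ (Q d 1).card * (Q (n - d) b).card := Finset.card_image₂_le _ _ _
      _ ≤ Nat.card K ^ (d - 1) * Nat.card K ^ (n - d - 1) :=
          Nat.mul_le_mul (hQ _ _ (by omega)).2 (hQ _ _ (by omega)).2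
      _ = _ := by rw [← pow_add]; congr 1; omega

/-! ### The probability bound -/

theorem Matrix.SpecialLinearGroup.ncard_hasProperFactor_mul_le {K : Type*} [Field K] [Finite K]
    (n : ℕ) :
    {M : SL(n, K) | HasProperFactorWithConstTerm
      (M : Matrix (Fin n) (Fin n) K).charpoly 1}.ncard * Nat.card K ≤
      n * 2 ^ (n ^ 2 + n) * Nat.card SL(n, K) := by
  set S := {M : SL(n, K) | HasProperFactorWithConstTerm
      (M : Matrix (Fin n) (Fin n) K).charpoly 1}
  set q := Nat.card K
  obtain hn | hn := lt_or_ge n 2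
  · have : S = ∅ := Set.eq_empty_of_forall_notMem fun M ⟨g, _, _, h1, h2, _⟩ ↦ by
      rw [Matrix.charpoly_natDegree_eq_dim, Fintype.card_fin] at h2
      omega
    simp [this]
  -- The constant term of the characteristic polynomial is `(-1) ^ n * det M = (-1) ^ n`.
  obtain ⟨F, hF, hFcard⟩ := Polynomial.exists_finset_hasProperFactor_card_le n ((-1 : K) ^ n)
  have hcover : ∀ M ∈ S, (M : Matrix (Fin n) (Fin n) K) ∈
      ⋃ f ∈ F, {A : Matrix (Fin n) (Fin n) K | A.charpoly = f} := fun M hM ↦ by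
    simp only [Set.mem_iUnion]
    refine ⟨_, hF _ (Matrix.charpoly_monic _) (by simp) ?_ hM, rfl⟩
    have := Matrix.det_eq_sign_charpoly_coeff (M : Matrix (Fin n) (Fin n) K)
    rw [M.det_coe, Fintype.card_fin] at this
    calc (M : Matrix (Fin n) (Fin n) K).charpoly.coeff 0
        = (-1) ^ n * ((-1) ^ n * (M : Matrix (Fin n) (Fin n) K).charpoly.coeff 0) := by
          rw [← mul_assoc, ← mul_pow]; simp
      _ = (-1) ^ n := by rw [← this, mul_one]
  have hS : S.ncard ≤ n * q ^ (n - 2) * (2 ^ n ^ 2 * q ^ (n * (n - 1))) :=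
    calc S.ncard ≤ (⋃ f ∈ F, {A : Matrix (Fin n) (Fin n) K | A.charpoly = f}).ncard :=
          Set.ncard_le_ncard_of_injOn _ hcover Subtype.val_injective.injOn
      _ ≤ ∑ f ∈ F, {A : Matrix (Fin n) (Fin n) K | A.charpoly = f}.ncard :=
          F.set_ncard_biUnion_le _
      _ ≤ F.card * (2 ^ n ^ 2 * q ^ (n * (n - 1))) :=
          Finset.sum_le_card_nsmul _ _ _ fun f _ ↦ Matrix.ncard_charpoly_eq_le n f
      _ ≤ _ := Nat.mul_le_mul_right _ hFcard
  have hq : 0 < q := Nat.card_pos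
  have hexp : n ^ 2 = n - 2 + n * (n - 1) + 1 + 1 := by
    obtain ⟨m, rfl⟩ := Nat.exists_eq_add_of_le' hn
    simp only [Nat.add_sub_cancel, show m + 2 - 1 = m + 1 by omega]
    ring
  have hSL : q ^ (n - 2 + n * (n - 1) + 1) ≤ 2 ^ n * Nat.card SL(n, K) :=
    Nat.le_of_mul_le_mul_right (by
      rw [← pow_succ, ← hexp]; exact Matrix.SpecialLinearGroup.pow_le_card n) hq
  calc S.ncard * q ≤ n * q ^ (n - 2) * (2 ^ n ^ 2 * q ^ (n * (n - 1))) * q :=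
        Nat.mul_le_mul_right _ hS
    _ = n * 2 ^ n ^ 2 * q ^ (n - 2 + n * (n - 1) + 1) := by ring
    _ ≤ n * 2 ^ n ^ 2 * (2 ^ n * Nat.card SL(n, K)) := Nat.mul_le_mul_left _ hSL
    _ = _ := by ring

theorem mainTheorem10 (n : ℕ) :
    ∃ C : ℝ, 0 < C ∧ ∀ p : ℕ, p.Prime →
      slProb n p
        {M : SL(n, ZMod p) |
          HasProperFactorWithConstTerm (M : Matrix (Fin n) (Fin n) (ZMod p)).charpoly 1} ≤
        C / (p : ℝ) := by
  -- The summand `1` only keeps the constant positive when `n = 0`.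
  refine ⟨n * 2 ^ (n ^ 2 + n) + 1, by positivity, fun p hp ↦ ?_⟩
  have : Fact p.Prime := ⟨hp⟩
  have hcard : (0 : ℝ) < Nat.card SL(n, ZMod p) := by exact_mod_cast Nat.card_pos
  have hp0 : (0 : ℝ) < p := by exact_mod_cast hp.pos
  have h := Matrix.SpecialLinearGroup.ncard_hasProperFactor_mul_le (K := ZMod p) n
  rw [Nat.card_zmod, ← Nat.card_coe_set_eq] at h
  rw [slProb, div_le_div_iff₀ hcard hp0]
  have h' : (Nat.card {M : SL(n, ZMod p) | HasProperFactorWithConstTerm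
      (M : Matrix (Fin n) (Fin n) (ZMod p)).charpoly 1} : ℝ) * p ≤
      n * 2 ^ (n ^ 2 + n) * Nat.card SL(n, ZMod p) := by exact_mod_cast h
  linarith
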